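/- Let $n\ge 2$. For $A\subseteq\mathbb R^n$ let $A^c=\bigcap_{x\in A}B(x,1)$, where $B(x,1)$ is the closed Euclidean unit ball centred at $x$ (with $\emptyset^c=\mathbb R^n$), and let $\mathrm{conv}_c(A)=(A^c)^c$ be its $c$-hull. Let $\mathcal S_n$ be the class of all sets of the form $K=\bigcap_{x\in A}B(x,1)$ with $A\subseteq\mathbb R^n$. The out-radius $\mathrm{Outrad}(K)$ is the infimum of all $R\ge 0$ such that $K$ is contained in a closed Euclidean ball of radius $R$ ($+\infty$ if there is none). A point $x\in K$ is called $c$-extremal for $K$ if for all $y,z\in K$, $x\in\mathrm{conv}_c(\{y,z\})$ implies $y=x$ or $z=x$; the set of such points is denoted $\mathrm{ext}_c(K)$. Theorem. Let $K\in\mathcal S_n$ with $\mathrm{Outrad}(K)<1$. Then: (i) for every $x\in\partial K$ there are $m\le n$ and points $x_1,\dots,x_m\in\mathrm{ext}_c(K)$ such that $x\in\mathrm{conv}_c(\{x_1,\dots,x_m\})$; (ii) for every $x\in K$ there are $m\le n+1$ and points $x_1,\dots,x_m\in\mathrm{ext}_c(K)$ such that $x\in\mathrm{conv}_c(\{x_1,\dots,x_m\})$;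 (iii) $K=\mathrm{conv}_c(\mathrm{ext}_c(K))$. -/

import Mathlib

open scoped ENNReal NNReal

noncomputable section

/-- The `c`-dual of a set `A` in `ℝⁿ`: the intersection of the closed Euclidean unit balls centred
at the points of `A` (all of `ℝⁿ` when `A` is empty). -/
def cDual {n : ℕ} (A : Set (EuclideanSpace ℝ (Fin n))) : Set (EuclideanSpace ℝ (Fin n)) :=
  ⋂ x ∈ A, Metric.closedBall x 1

/-- The `c`-hull `conv_c A = A^{cc}`. -/
def cHull {n : ℕ} (A : Set (EuclideanSpace ℝ (Fin n))) : Set (EuclideanSpace ℝ (Fin n)) :=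
  cDual (cDual A)

/-- `K` is a ball-body (`K ∈ 𝒮ₙ`): an intersection of closed Euclidean unit balls. -/
def IsBallBody {n : ℕ} (K : Set (EuclideanSpace ℝ (Fin n))) : Prop :=
  ∃ A : Set (EuclideanSpace ℝ (Fin n)), K = ⋂ x ∈ A, Metric.closedBall x 1

/-- The out-radius of `A`: the infimum of the radii `R ≥ 0` of the closed balls containing `A`,
taken in `[0, ∞]`, so that unbounded sets have out-radius `∞`. -/
def outradius {n : ℕ} (A : Set (EuclideanSpace ℝ (Fin n))) : ℝ≥0∞ :=
  ⨅ (x : EuclideanSpace ℝ (Fin n)) (R : ℝ≥0) (_ : A ⊆ Metric.closedBall x (R : ℝ)), (R : ℝ≥0∞)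

/-- The set `ext_c K` of `c`-extremal points of `K`. -/
def cExt {n : ℕ} (K : Set (EuclideanSpace ℝ (Fin n))) : Set (EuclideanSpace ℝ (Fin n)) :=
  {x | x ∈ K ∧ ∀ y ∈ K, ∀ z ∈ K, x ∈ cHull {y, z} → y = x ∨ z = x}

end

open scoped InnerProductSpace

/-! ### Duality, and how conic combinations relate to `c`-hulls. -/

section Duality

variable {n : ℕ}

/-! A boundary point `x` lies on the unit sphere about some `u` in the dual of `K`. If `K` lies in a
ball about `w` of radius `R < 1`, the vectors `a - u`, for `a` in `K` on that sphere, stay in an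
open half-space with normal `w - u`. So the coefficients of the representations of `x - u` as conic
combinations of `n` such vectors are bounded, and by compactness one has largest total weight. Its
points of positive weight are `c`-extremal. Otherwise some `a i` is in the `c`-hull of two other
points `y`, `z` of `K`; these lie on the sphere, and `a i - u = α • (y - u) + β • (z - u)` with `α +
β > 1` by strict convexity. Substituting raises the weight, and a Carathéodory reduction that never
lowers it returns to `n` points: a contradiction. Conic combinations on the sphere lie in the
`c`-hull, which gives (i). A ray from one extremal point to the boundary gives (ii), hence (iii). -/

theorem mem_cDual {A : Set (EuclideanSpace ℝ (Fin n))} {x : EuclideanSpace ℝ (Fin n)} :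
    x ∈ cDual A ↔ ∀ a ∈ A, ‖x - a‖ ≤ 1 := by
  simp [cDual, dist_eq_norm]

theorem cDual_anti {A B : Set (EuclideanSpace ℝ (Fin n))} (h : A ⊆ B) : cDual B ⊆ cDual A :=
  fun _ hx => mem_cDual.2 fun a ha => mem_cDual.1 hx a (h ha)

theorem cHull_mono {A B : Set (EuclideanSpace ℝ (Fin n))} (h : A ⊆ B) : cHull A ⊆ cHull B :=
  cDual_anti (cDual_anti h)

theorem subset_cHull (A : Set (EuclideanSpace ℝ (Fin n))) : A ⊆ cHull A := fun x hx =>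
  mem_cDual.2 fun u hu => by
    rw [norm_sub_rev]
    exact mem_cDual.1 hu x hx

theorem isClosed_cDual (A : Set (EuclideanSpace ℝ (Fin n))) : IsClosed (cDual A) :=
  isClosed_biInter fun _ _ => Metric.isClosed_closedBall

theorem convex_cDual (A : Set (EuclideanSpace ℝ (Fin n))) : Convex ℝ (cDual A) :=
  convex_iInter₂ fun _ _ => convex_closedBall _ _

theorem isCompact_cDual {A : Set (EuclideanSpace ℝ (Fin n))} (hA : A.Nonempty) :
    IsCompact (cDual A) := by
  obtain ⟨a, ha⟩ := hA
  refine (isCompact_closedBall a 1).of_isClosed_subset (isClosed_cDual A) fun x hx => ?_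
  rw [mem_closedBall_iff_norm]
  exact mem_cDual.1 hx a ha

/-- The dual reverses inclusions and every set lies in its bidual, so a triple dual is a dual. -/
theorem IsBallBody.cHull_eq {K : Set (EuclideanSpace ℝ (Fin n))} (hK : IsBallBody K) :
    cHull K = K := by
  obtain ⟨A, rfl⟩ := hK
  exact (cDual_anti (subset_cHull A)).antisymm (subset_cHull (cDual A))

theorem exists_subset_closedBall_of_outradius_lt_one {K : Set (EuclideanSpace ℝ (Fin n))}
    (hR : outradius K < 1) :
    ∃ (w : EuclideanSpace ℝ (Fin n)) (R : ℝ), 0 ≤ R ∧ R < 1 ∧ ∀ a ∈ K, ‖a - w‖ ≤ R := by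
  simp only [outradius, iInf_lt_iff] at hR
  obtain ⟨w, R, h, hR⟩ := hR
  refine ⟨w, R, R.2, by exact_mod_cast hR, fun a ha => ?_⟩
  rw [← mem_closedBall_iff_norm]
  exact h ha

/-- A boundary point of a ball-body lies on the boundary of a unit ball containing the body. -/
theorem exists_mem_cDual_norm_sub_eq_one {K : Set (EuclideanSpace ℝ (Fin n))}
    (hK : cHull K = K) (hd : (cDual K).Nonempty) {x : EuclideanSpace ℝ (Fin n)}
    (hx : x ∈ frontier K) : ∃ u ∈ cDual K, ‖x - u‖ = 1 := by
  have hKc : IsClosed K := hK ▸ isClosed_cDual _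
  have hxK : x ∈ K := hKc.frontier_subset hx
  obtain ⟨u, hu, hmax⟩ := (isCompact_cDual ⟨x, hxK⟩).exists_isMaxOn hd
    (f := fun u => ‖x - u‖) (by fun_prop)
  refine ⟨u, hu, ?_⟩
  by_contra hne
  have hle : ‖x - u‖ ≤ 1 := by
    rw [norm_sub_rev]
    exact mem_cDual.1 hu x hxK
  have hlt := lt_of_le_of_ne hle hne
  -- As `u` is farthest from `x` in the dual, this radius keeps the ball inside every defining unit
  -- ball.
  refine hx.2 (mem_interior.2 ⟨Metric.ball x (1 - ‖x - u‖), fun z hz => ?_, Metric.isOpen_ball,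
    Metric.mem_ball_self (by linarith)⟩)
  rw [← hK]
  refine mem_cDual.2 fun v hv => ?_
  have h1 : ‖x - v‖ ≤ ‖x - u‖ := hmax hv
  have h2 := norm_sub_le_norm_sub_add_norm_sub z x v
  rw [mem_ball_iff_norm] at hz
  linarith

/-- Unit vectors in a cone based at `u` give points of the `c`-hull of the generators. -/
theorem mem_cHull_of_conic_combination {ι : Type*} [Fintype ι]
    {u x : EuclideanSpace ℝ (Fin n)} {a : ι → EuclideanSpace ℝ (Fin n)} {l : ι → ℝ}
    (hl : ∀ i, 0 ≤ l i) (ha : ∀ i, ‖a i - u‖ = 1) (hx : ‖x - u‖ = 1)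
    (h : ∑ i, l i • (a i - u) = x - u) : x ∈ cHull (Set.range a) := by
  refine mem_cDual.2 fun q hq => ?_
  have hsum : 1 ≤ ∑ i, l i := by
    rw [← hx, ← h]
    refine (norm_sum_le _ _).trans (Finset.sum_le_sum fun i _ => ?_)
    rw [norm_smul, ha i, mul_one, Real.norm_of_nonneg (hl i)]
  -- For `‖a i - u‖ = 1`, this is `‖q - a i‖ ≤ 1` rewritten linearly in `a i - u`; it survives conic
  -- combinations of total weight at least 1.
  have hi : ∀ i, ‖q - u‖ ^ 2 / 2 ≤ ⟪a i - u, q - u⟫_ℝ := fun i => by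
    have h1 := mem_cDual.1 hq (a i) ⟨i, rfl⟩
    have h2 := norm_sub_sq_real (a i - u) (q - u)
    rw [sub_sub_sub_cancel_right, norm_sub_rev, ha i] at h2
    have h3 : ‖q - a i‖ ^ 2 ≤ 1 := pow_le_one₀ (norm_nonneg _) h1
    linarith
  have h4 : ‖q - u‖ ^ 2 / 2 ≤ ⟪x - u, q - u⟫_ℝ := by
    rw [← h, sum_inner]
    calc ‖q - u‖ ^ 2 / 2 ≤ (∑ i, l i) * (‖q - u‖ ^ 2 / 2) :=
          le_mul_of_one_le_left (by positivity) hsum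
      _ = ∑ i, l i * (‖q - u‖ ^ 2 / 2) := Finset.sum_mul ..
      _ ≤ ∑ i, ⟪l i • (a i - u), q - u⟫_ℝ := Finset.sum_le_sum fun i _ => by
          rw [real_inner_smul_left]
          exact mul_le_mul_of_nonneg_left (hi i) (hl i)
  have h2 := norm_sub_sq_real (x - u) (q - u)
  rw [sub_sub_sub_cancel_right, hx] at h2
  exact (sq_le_one_iff₀ (norm_nonneg _)).1 (by linarith)

/-- A direction in which one can move the ball `B(u, 1)` away from `x` while keeping `y` and `z`
inside shows that `x` is not in the `c`-hull of `y` and `z`. -/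
theorem notMem_cHull_pair_of_inner {u x y z v : EuclideanSpace ℝ (Fin n)}
    (hx : ‖x - u‖ = 1) (hv : 0 < ⟪v, x - u⟫_ℝ)
    (hy : ‖y - u‖ < 1 ∨ ‖y - u‖ = 1 ∧ ⟪v, y - u⟫_ℝ < 0)
    (hz : ‖z - u‖ < 1 ∨ ‖z - u‖ = 1 ∧ ⟪v, z - u⟫_ℝ < 0) : x ∉ cHull {y, z} := by
  have expand : ∀ (a : EuclideanSpace ℝ (Fin n)) (t : ℝ),
      ‖a - (u - t • v)‖ ^ 2 = ‖a - u‖ ^ 2 + 2 * t * ⟪v, a - u⟫_ℝ + t ^ 2 * ‖v‖ ^ 2 := by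
    intro a t
    have : a - (u - t • v) = (a - u) + t • v := by abel
    rw [this, norm_add_sq_real, real_inner_smul_right, norm_smul, mul_pow, Real.norm_eq_abs,
      sq_abs, real_inner_comm]
    ring
  have key : ∀ a : EuclideanSpace ℝ (Fin n),
      (‖a - u‖ < 1 ∨ ‖a - u‖ = 1 ∧ ⟪v, a - u⟫_ℝ < 0) →
      ∀ᶠ t in nhdsWithin (0 : ℝ) (Set.Ioi 0), ‖a - (u - t • v)‖ ^ 2 ≤ 1 := by
    rintro a (ha | ⟨ha, hneg⟩)
    · have hc : Continuous fun t : ℝ => ‖a - (u - t • v)‖ ^ 2 := by fun_prop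
      have h0 : ‖a - (u - (0 : ℝ) • v)‖ ^ 2 < 1 := by
        rw [zero_smul, sub_zero]
        exact pow_lt_one₀ (norm_nonneg _) ha two_ne_zero
      filter_upwards [(hc.tendsto 0).eventually_lt_const h0 |>.filter_mono nhdsWithin_le_nhds]
        with t ht using ht.le
    · have hc : Continuous fun t : ℝ => 2 * ⟪v, a - u⟫_ℝ + t * ‖v‖ ^ 2 := by fun_prop
      have h0 : 2 * ⟪v, a - u⟫_ℝ + (0 : ℝ) * ‖v‖ ^ 2 < 0 := by linarith
      filter_upwards [(hc.tendsto 0).eventually_lt_const h0 |>.filter_mono nhdsWithin_le_nhds,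
        self_mem_nhdsWithin] with t ht htpos
      rw [expand, ha]
      have := mul_neg_of_pos_of_neg (Set.mem_Ioi.1 htpos) ht
      linarith
  obtain ⟨t, hty, htz, ht⟩ := ((key y hy).and ((key z hz).and self_mem_nhdsWithin)).exists
  have ht : 0 < t := ht
  intro hmem
  have hu : u - t • v ∈ cDual {y, z} := mem_cDual.2 fun a ha => by
    rw [norm_sub_rev]
    rcases ha with rfl | rfl
    · exact (sq_le_one_iff₀ (norm_nonneg _)).1 hty
    · exact (sq_le_one_iff₀ (norm_nonneg _)).1 htz
  have h1 := (sq_le_one_iff₀ (norm_nonneg _)).2 (mem_cDual.1 hmem _ hu)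
  rw [expand, hx] at h1
  have := mul_pos ht hv
  have : 0 ≤ t ^ 2 * ‖v‖ ^ 2 := by positivity
  linarith

end Duality

/-! ### Cones in an open half-space. -/

section Cone

variable {E : Type*} [NormedAddCommGroup E] [InnerProductSpace ℝ E]

/-- Strict separation of a vector from the cone generated by two vectors, all of them in an open
half-space. -/
theorem exists_conic_pair_or_separation [CompleteSpace E] {e X Y Z : E} (hX : 0 < ⟪e, X⟫_ℝ)
    (hY : 0 < ⟪e, Y⟫_ℝ) (hZ : 0 < ⟪e, Z⟫_ℝ) :
    (∃ α β : ℝ, 0 ≤ α ∧ 0 ≤ β ∧ α • Y + β • Z = X) ∨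
      ∃ v : E, 0 < ⟪v, X⟫_ℝ ∧ ⟪v, Y⟫_ℝ < 0 ∧ ⟪v, Z⟫_ℝ < 0 := by
  -- Rescaling to the slice `⟪e, ·⟫ = 1` turns the cone into a compact segment.
  by_cases h : (⟪e, X⟫_ℝ)⁻¹ • X ∈ segment ℝ ((⟪e, Y⟫_ℝ)⁻¹ • Y) ((⟪e, Z⟫_ℝ)⁻¹ • Z)
  · left
    obtain ⟨a, b, ha, hb, -, hab⟩ := h
    refine ⟨⟪e, X⟫_ℝ * (a * (⟪e, Y⟫_ℝ)⁻¹), ⟪e, X⟫_ℝ * (b * (⟪e, Z⟫_ℝ)⁻¹), by positivity,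
      by positivity, ?_⟩
    rw [mul_smul, mul_smul _ (b * _), mul_smul a, mul_smul b, ← smul_add, hab, smul_smul,
      mul_inv_cancel₀ hX.ne', one_smul]
  · right
    have hc : IsClosed (segment ℝ ((⟪e, Y⟫_ℝ)⁻¹ • Y) ((⟪e, Z⟫_ℝ)⁻¹ • Z)) := by
      rw [← convexHull_pair]
      exact ((Set.toFinite _).isCompact_convexHull ℝ).isClosed
    obtain ⟨f, s, hf, hs⟩ := geometric_hahn_banach_closed_point (convex_segment _ _) hc h
    have hfY := hf _ (left_mem_segment ..)
    have hfZ := hf _ (right_mem_segment ..)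
    rw [map_smul, smul_eq_mul, inv_mul_eq_div] at hfY hfZ hs
    rw [div_lt_iff₀ ‹_›] at hfY hfZ
    rw [lt_div_iff₀ hX] at hs
    -- On the slice, subtracting `s • e` moves the separating level `s` to zero, making the
    -- separation homogeneous.
    refine ⟨(InnerProductSpace.toDual ℝ E).symm f - s • e, ?_, ?_, ?_⟩ <;>
    · rw [inner_sub_left, InnerProductSpace.toDual_symm_apply, real_inner_smul_left]
      linarith

/-- If a unit vector is a conic combination of two other unit vectors, the coefficients have sum
larger than one. -/
theorem one_lt_add_of_conic_pair {X Y Z : E} (hX : ‖X‖ = 1) (hY : ‖Y‖ = 1) (hZ : ‖Z‖ = 1)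
    (hYX : Y ≠ X) (hZX : Z ≠ X) {α β : ℝ} (hα : 0 ≤ α) (hβ : 0 ≤ β) (h : α • Y + β • Z = X) :
    1 < α + β := by
  have hle : 1 ≤ α + β := by
    rw [← hX, ← h]
    refine (norm_add_le _ _).trans_eq ?_
    rw [norm_smul, norm_smul, hY, hZ, Real.norm_of_nonneg hα, Real.norm_of_nonneg hβ, mul_one,
      mul_one]
  refine lt_of_le_of_ne hle fun heq => ?_
  have h1 := norm_add_sq_real (α • Y) (β • Z)
  rw [h, hX, norm_smul, norm_smul, hY, hZ, Real.norm_of_nonneg hα, Real.norm_of_nonneg hβ,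
    real_inner_smul_left, real_inner_smul_right] at h1
  have h2 : α * β * (1 - ⟪Y, Z⟫_ℝ) = 0 := by
    have : (α + β) ^ 2 = 1 := by rw [← heq]; norm_num
    linarith
  rcases mul_eq_zero.1 h2 with h3 | h3
  · rcases mul_eq_zero.1 h3 with rfl | rfl
    · rw [zero_add] at heq
      rw [← heq, zero_smul, zero_add, one_smul] at h
      exact hZX h
    · rw [add_zero] at heq
      rw [← heq, zero_smul, add_zero, one_smul] at h
      exact hYX h
  · have : Y = Z := (inner_eq_one_iff_of_norm_eq_one (𝕜 := ℝ) hY hZ).1 (by linarith)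
    subst this
    rw [← add_smul, ← heq, one_smul] at h
    exact hYX h

/-- Conic Carathéodory reduction in an open half-space which does not decrease the total weight. -/
theorem exists_conic_reduction {ι : Type*} [Fintype ι] [FiniteDimensional ℝ E]
    (hcard : Module.finrank ℝ E < Fintype.card ι) {e : E} {v : ι → E}
    (hv : ∀ i, 0 < ⟪e, v i⟫_ℝ) {l : ι → ℝ} (hl : ∀ i, 0 ≤ l i) :
    ∃ (l' : ι → ℝ) (j : ι), (∀ i, 0 ≤ l' i) ∧ l' j = 0 ∧
      ∑ i, l' i • v i = ∑ i, l i • v i ∧ ∑ i, l i ≤ ∑ i, l' i := by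
  classical
  have hdep : ¬ LinearIndependent ℝ v := fun h => by
    have := h.fintype_card_le_finrank
    omega
  -- The sign of the relation is free; a nonnegative sum keeps the total weight from dropping.
  obtain ⟨c, hc0, hcpos, hcne⟩ :
      ∃ c : ι → ℝ, ∑ i, c i • v i = 0 ∧ 0 ≤ ∑ i, c i ∧ ∃ i, c i ≠ 0 := by
    obtain ⟨c, hc0, i, hi⟩ := Fintype.not_linearIndependent_iff.1 hdep
    rcases le_total 0 (∑ i, c i) with h | h
    · exact ⟨c, hc0, h, i, hi⟩
    · refine ⟨-c, ?_, ?_, i, ?_⟩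
      · simp [hc0]
      · simpa using h
      · simpa using hi
  obtain ⟨i₀, hi₀⟩ : ∃ i, c i < 0 := by
    by_contra! hnn
    obtain ⟨i, hi⟩ := hcne
    have h1 : ∑ k, c k * ⟪e, v k⟫_ℝ = 0 := by
      simpa [inner_sum, real_inner_smul_right] using congrArg (fun w => ⟪e, w⟫_ℝ) hc0
    rw [Finset.sum_eq_zero_iff_of_nonneg fun k _ => mul_nonneg (hnn k) (hv k).le] at h1
    rcases mul_eq_zero.1 (h1 i (Finset.mem_univ i)) with h | h
    · exact hi h
    · exact (hv i).ne' h
  obtain ⟨j, hj, hmin⟩ := Finset.exists_min_image (Finset.univ.filter fun i => c i < 0)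
    (fun i => l i / (-c i)) ⟨i₀, by simp [hi₀]⟩
  have hj : c j < 0 := by simpa using hj
  have ht : 0 ≤ l j / (-c j) := div_nonneg (hl j) (by linarith)
  refine ⟨fun i => l i + l j / (-c j) * c i, j, fun i => ?_, ?_, ?_, ?_⟩
  · rcases lt_or_ge (c i) 0 with hi | hi
    · have h1 := hmin i (by simp [hi])
      rw [le_div_iff₀ (by linarith)] at h1
      linarith
    · exact add_nonneg (hl i) (mul_nonneg ht hi)
  · have := hj.ne
    field_simp
    ring
  · simp_rw [add_smul, Finset.sum_add_distrib, mul_smul, ← Finset.smul_sum, hc0, smul_zero,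
      add_zero]
  · rw [Finset.sum_add_distrib, ← Finset.mul_sum]
    exact le_add_of_nonneg_right (mul_nonneg ht hcpos)

end Cone

/-! ### Extremal representations and the Carathéodory statements. -/

section Extremal

variable {n : ℕ}

/-- If a point of the unit sphere about `u` lies in the `c`-hull of two other points of the ball,
these two points lie on the sphere and generate a cone containing it. -/
theorem exists_conic_pair_of_mem_cHull {u x y z e : EuclideanSpace ℝ (Fin n)}
    (hx : ‖x - u‖ = 1) (hy : ‖y - u‖ ≤ 1) (hz : ‖z - u‖ ≤ 1)
    (he : ∀ a ∈ ({x, y, z} : Set (EuclideanSpace ℝ (Fin n))), ‖a - u‖ = 1 → 0 < ⟪e, a - u⟫_ℝ)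
    (hyx : y ≠ x) (hzx : z ≠ x) (h : x ∈ cHull {y, z}) :
    ‖y - u‖ = 1 ∧ ‖z - u‖ = 1 ∧
      ∃ α β : ℝ, 0 ≤ α ∧ 0 ≤ β ∧ α • (y - u) + β • (z - u) = x - u := by
  have hex := he x (by simp) hx
  -- The separation lemma with both generators equal to `a`: a unit multiple of `a - u` could only
  -- be `a - u` itself.
  have single : ∀ a ∈ ({x, y, z} : Set (EuclideanSpace ℝ (Fin n))), ‖a - u‖ = 1 → a ≠ x →
      ∃ v, 0 < ⟪v, x - u⟫_ℝ ∧ ⟪v, a - u⟫_ℝ < 0 := by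
    intro a ha hau hax
    have hea := he a ha hau
    rcases exists_conic_pair_or_separation hex hea hea with ⟨α, β, hα, hβ, hαβ⟩ | ⟨v, h1, h2, -⟩
    · have hne : a - u ≠ x - u := fun h => hax (sub_left_injective h)
      have hlt := one_lt_add_of_conic_pair hx hau hau hne hne hα hβ hαβ
      have h1 := congrArg norm hαβ
      rw [← add_smul, norm_smul, hau, hx, Real.norm_of_nonneg (by positivity)] at h1
      linarith
    · exact ⟨v, h1, h2⟩
  rcases hy.lt_or_eq with hy | hy <;> rcases hz.lt_or_eq with hz | hz
  · refine absurd h (notMem_cHull_pair_of_inner (v := x - u) hx ?_ (.inl hy) (.inl hz))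
    rw [real_inner_self_eq_norm_sq, hx]
    norm_num
  · obtain ⟨v, h1, h2⟩ := single z (by simp) hz hzx
    exact absurd h (notMem_cHull_pair_of_inner hx h1 (.inl hy) (.inr ⟨hz, h2⟩))
  · obtain ⟨v, h1, h2⟩ := single y (by simp) hy hyx
    exact absurd h (notMem_cHull_pair_of_inner hx h1 (.inr ⟨hy, h2⟩) (.inl hz))
  · refine ⟨hy, hz, ?_⟩
    rcases exists_conic_pair_or_separation hex (he y (by simp) hy) (he z (by simp) hz) with
      h1 | ⟨v, h1, h2, h3⟩
    · exact h1
    · exact absurd h (notMem_cHull_pair_of_inner hx h1 (.inr ⟨hy, h2⟩) (.inr ⟨hz, h3⟩))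

/-- Among the conic representations of `x - u` by `n` points of `K` on the sphere about `u`, there
is one of largest total weight. -/
theorem exists_maximal_conic_representation (hn : 0 < n) {K : Set (EuclideanSpace ℝ (Fin n))}
    (hK : IsCompact K) {u x e : EuclideanSpace ℝ (Fin n)} {δ : ℝ} (hδ : 0 < δ)
    (he : ∀ a ∈ K, ‖a - u‖ = 1 → δ ≤ ⟪e, a - u⟫_ℝ) (hxK : x ∈ K) (hx : ‖x - u‖ = 1) :
    ∃ (l : Fin n → ℝ) (a : Fin n → EuclideanSpace ℝ (Fin n)),
      (∀ i, 0 ≤ l i) ∧ (∀ i, a i ∈ K ∧ ‖a i - u‖ = 1) ∧ ∑ i, l i • (a i - u) = x - u ∧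
      ∀ (l' : Fin n → ℝ) (a' : Fin n → EuclideanSpace ℝ (Fin n)),
        (∀ i, 0 ≤ l' i) → (∀ i, a' i ∈ K ∧ ‖a' i - u‖ = 1) →
        ∑ i, l' i • (a' i - u) = x - u → ∑ i, l' i ≤ ∑ i, l i := by
  let S : Set ((Fin n → ℝ) × (Fin n → EuclideanSpace ℝ (Fin n))) :=
    {p | (∀ i, 0 ≤ p.1 i) ∧ (∀ i, p.2 i ∈ K ∧ ‖p.2 i - u‖ = 1) ∧
      ∑ i, p.1 i • (p.2 i - u) = x - u}
  have hSclosed : IsClosed S := by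
    refine IsClosed.inter (isClosed_le (by fun_prop) (by fun_prop) : IsClosed
      {p : (Fin n → ℝ) × (Fin n → EuclideanSpace ℝ (Fin n)) | 0 ≤ p.1})
      (IsClosed.inter ?_ (isClosed_eq (by fun_prop) (by fun_prop)))
    have : {p : (Fin n → ℝ) × (Fin n → EuclideanSpace ℝ (Fin n)) |
        ∀ i, p.2 i ∈ K ∧ ‖p.2 i - u‖ = 1} =
        ⋂ i, ((fun p => p.2 i) ⁻¹' K ∩ {p | ‖p.2 i - u‖ = 1}) := by
      ext p
      simp
    change IsClosed {p : (Fin n → ℝ) × (Fin n → EuclideanSpace ℝ (Fin n)) |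
        ∀ i, p.2 i ∈ K ∧ ‖p.2 i - u‖ = 1}
    rw [this]
    exact isClosed_iInter fun i => (hK.isClosed.preimage (by fun_prop)).inter
      (isClosed_eq (by fun_prop) (by fun_prop))
  have hScompact : IsCompact S := by
    -- Pairing the representation with `e` bounds each coefficient by `⟪e, x - u⟫ / δ`.
    refine ((isCompact_Icc (a := (0 : Fin n → ℝ)) (b := fun _ => ⟪e, x - u⟫_ℝ / δ)).prod
      (isCompact_univ_pi fun _ => hK)).of_isClosed_subset hSclosed ?_
    rintro ⟨l, a⟩ ⟨hl, ha, hs⟩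
    refine ⟨⟨hl, fun i => ?_⟩, fun i _ => (ha i).1⟩
    rw [le_div_iff₀ hδ]
    have hs : ∑ i, l i • (a i - u) = x - u := hs
    rw [← hs, inner_sum]
    simp_rw [real_inner_smul_right]
    refine (mul_le_mul_of_nonneg_left (he _ (ha i).1 (ha i).2) (hl i)).trans ?_
    exact Finset.single_le_sum (f := fun i => l i * ⟪e, a i - u⟫_ℝ)
      (fun k _ => mul_nonneg (hl k) (hδ.le.trans (he _ (ha k).1 (ha k).2))) (Finset.mem_univ i)
  have hSne : S.Nonempty := by
    refine ⟨(Pi.single ⟨0, hn⟩ 1, fun _ => x), fun i => ?_, fun _ => ⟨hxK, hx⟩, ?_⟩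
    · rcases eq_or_ne i ⟨0, hn⟩ with rfl | h
      · simp
      · simp [h]
    · dsimp only
      rw [← Finset.sum_smul]
      simp
  obtain ⟨⟨l, a⟩, ⟨hl, ha, hs⟩, hmax⟩ := hScompact.exists_isMaxOn hSne
    (f := fun p => ∑ i, p.1 i) (by fun_prop)
  exact ⟨l, a, hl, ha, hs, fun l' a' h1 h2 h3 => hmax (show (l', a') ∈ S from ⟨h1, h2, h3⟩)⟩

/-- A representation of largest total weight uses only `c`-extremal points. -/
theorem mem_cExt_of_maximal_conic_representation {K : Set (EuclideanSpace ℝ (Fin n))}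
    {u x e : EuclideanSpace ℝ (Fin n)} (hu : u ∈ cDual K)
    (he : ∀ a ∈ K, ‖a - u‖ = 1 → 0 < ⟪e, a - u⟫_ℝ)
    {l : Fin n → ℝ} {a : Fin n → EuclideanSpace ℝ (Fin n)}
    (hl : ∀ i, 0 ≤ l i) (ha : ∀ i, a i ∈ K ∧ ‖a i - u‖ = 1)
    (hs : ∑ i, l i • (a i - u) = x - u)
    (hmax : ∀ (l' : Fin n → ℝ) (a' : Fin n → EuclideanSpace ℝ (Fin n)),
      (∀ i, 0 ≤ l' i) → (∀ i, a' i ∈ K ∧ ‖a' i - u‖ = 1) →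
      ∑ i, l' i • (a' i - u) = x - u → ∑ i, l' i ≤ ∑ i, l i)
    (i : Fin n) (hi : 0 < l i) : a i ∈ cExt K := by
  refine ⟨(ha i).1, fun y hy z hz hyz => ?_⟩
  by_contra! hne
  have hball : ∀ b ∈ K, ‖b - u‖ ≤ 1 := fun b hb => by
    rw [norm_sub_rev]
    exact mem_cDual.1 hu b hb
  obtain ⟨hyu, hzu, α, β, hα, hβ, hαβ⟩ := exists_conic_pair_of_mem_cHull (e := e) (ha i).2
    (hball y hy) (hball z hz) (fun b hb => he b (by
      rcases hb with rfl | rfl | rfl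
      exacts [(ha i).1, hy, hz])) hne.1 hne.2 hyz
  have hlt := one_lt_add_of_conic_pair (ha i).2 hyu hzu (fun h => hne.1 (sub_left_injective h))
    (fun h => hne.2 (sub_left_injective h)) hα hβ hαβ
  -- `y` takes the place of `a i` and `z` is added in front: one point too many, and total weight
  -- raised by `l i * (α + β - 1)`.
  let b : Fin (n + 1) → EuclideanSpace ℝ (Fin n) := Fin.cons z (Function.update a i y)
  let c : Fin (n + 1) → ℝ := Fin.cons (l i * β) (Function.update l i (l i * α))
  have hb : ∀ k, b k ∈ K ∧ ‖b k - u‖ = 1 := by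
    refine Fin.cases ⟨hz, hzu⟩ fun k => ?_
    rcases eq_or_ne k i with rfl | h
    · simpa [b] using ⟨hy, hyu⟩
    · simpa [b, h] using ha k
  have hc : ∀ k, 0 ≤ c k := by
    refine Fin.cases (mul_nonneg hi.le hβ) fun k => ?_
    rcases eq_or_ne k i with rfl | h
    · simpa [c] using mul_nonneg hi.le hα
    · simpa [c, h] using hl k
  have hcsum : ∑ k, c k = ∑ k, l k + l i * (α + β - 1) := by
    rw [Fin.sum_univ_succ, ← Finset.add_sum_erase _ _ (Finset.mem_univ i),
      ← Finset.add_sum_erase Finset.univ l (Finset.mem_univ i),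
      Finset.sum_congr rfl (g := l) fun k hk => by simp [c, Finset.ne_of_mem_erase hk]]
    simp only [c, Fin.cons_zero, Fin.cons_succ, Function.update_self]
    ring
  have hcs : ∑ k, c k • (b k - u) = x - u := by
    rw [← hs, Fin.sum_univ_succ, ← Finset.add_sum_erase _ _ (Finset.mem_univ i),
      ← Finset.add_sum_erase Finset.univ (fun k => l k • (a k - u)) (Finset.mem_univ i),
      Finset.sum_congr rfl (g := fun k => l k • (a k - u)) fun k hk => by
        simp [b, c, Finset.ne_of_mem_erase hk]]
    simp only [b, c, Fin.cons_zero, Fin.cons_succ, Function.update_self]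
    rw [← hαβ]
    module
  obtain ⟨c', j, hc', hj, hcs', hle⟩ := exists_conic_reduction (v := fun k => b k - u) (e := e)
    (by simp) (fun k => he _ (hb k).1 (hb k).2) hc
  have h1 := hmax (fun k => c' (j.succAbove k)) (fun k => b (j.succAbove k)) (fun k => hc' _)
    (fun k => hb _) (by
      rw [← hcs, ← hcs', Fin.sum_univ_succAbove _ j, hj, zero_smul, zero_add])
  rw [hcsum, Fin.sum_univ_succAbove _ j, hj, zero_add] at hle
  have := mul_pos hi (show 0 < α + β - 1 by linarith)
  linarith

/-- Carathéodory's theorem for `c`-extremal points, at boundary points. -/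
theorem exists_cExt_of_mem_frontier (hn : 0 < n) {K : Set (EuclideanSpace ℝ (Fin n))}
    (hK : cHull K = K) (hR : outradius K < 1) {x : EuclideanSpace ℝ (Fin n)}
    (hx : x ∈ frontier K) :
    ∃ m : ℕ, m ≤ n ∧ ∃ p : Fin m → EuclideanSpace ℝ (Fin n),
      (∀ i, p i ∈ cExt K) ∧ x ∈ cHull (Set.range p) := by
  obtain ⟨w, R, hR0, hR1, hw⟩ := exists_subset_closedBall_of_outradius_lt_one hR
  have hd : w ∈ cDual K := mem_cDual.2 fun a ha => by
    rw [norm_sub_rev]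
    exact (hw a ha).trans hR1.le
  have hKcompact : IsCompact K := hK ▸ isCompact_cDual ⟨w, hd⟩
  have hxK : x ∈ K := hKcompact.isClosed.frontier_subset hx
  obtain ⟨u, hu, hxu⟩ := exists_mem_cDual_norm_sub_eq_one hK ⟨w, hd⟩ hx
  have hδ : 0 < (1 - R ^ 2) / 2 := by
    have := pow_lt_one₀ hR0 hR1 two_ne_zero
    linarith
  -- Expand `‖(a - u) - (w - u)‖ ^ 2 ≤ R ^ 2` and drop `‖w - u‖ ^ 2`.
  have he : ∀ a ∈ K, ‖a - u‖ = 1 → (1 - R ^ 2) / 2 ≤ ⟪w - u, a - u⟫_ℝ := fun a ha hau => by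
    have h1 := norm_sub_sq_real (a - u) (w - u)
    rw [sub_sub_sub_cancel_right, hau, real_inner_comm] at h1
    have h2 := pow_le_pow_left₀ (norm_nonneg _) (hw a ha) 2
    have h3 := sq_nonneg ‖w - u‖
    linarith
  obtain ⟨l, a, hl, ha, hs, hmax⟩ :=
    exists_maximal_conic_representation hn hKcompact hδ he hxK hxu
  have hext := mem_cExt_of_maximal_conic_representation hu
    (fun b hb hbu => hδ.trans_le (he b hb hbu)) hl ha hs hmax
  let φ := (Fintype.equivFin {i : Fin n // 0 < l i}).symm
  refine ⟨Fintype.card {i : Fin n // 0 < l i}, ?_, fun k => a (φ k), fun k => hext _ (φ k).2, ?_⟩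
  · simpa using Fintype.card_subtype_le fun i : Fin n => 0 < l i
  · refine mem_cHull_of_conic_combination (l := fun k => l (φ k)) (fun _ => hl _)
      (fun _ => (ha _).2) hxu ?_
    rw [Equiv.sum_comp φ fun i => l i • (a i - u), ← hs]
    rw [← Finset.sum_subtype (Finset.univ.filter fun i => 0 < l i) (by simp)
      (fun i => l i • (a i - u))]
    refine Finset.sum_subset (Finset.subset_univ _) fun i _ hi => ?_
    have : l i = 0 := le_antisymm (by simpa using hi) (hl i)
    rw [this, zero_smul]

/-- A preconnected set meeting a set and its complement meets the frontier of that set. -/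
theorem inter_frontier_nonempty_of_isPreconnected {X : Type*} [TopologicalSpace X] {s t : Set X}
    (hs : IsPreconnected s) (h1 : (s ∩ t).Nonempty) (h2 : (s ∩ tᶜ).Nonempty) :
    (s ∩ frontier t).Nonempty := by
  by_contra hne
  have hf : ∀ z ∈ s, z ∉ frontier t := fun z hz hzf => hne ⟨z, hz, hzf⟩
  have hint : ∀ z ∈ s, z ∈ closure t → z ∈ interior t := fun z hz hzc => by
    by_contra hzi
    exact hf z hz ⟨hzc, hzi⟩
  obtain ⟨a, has, hat⟩ := h1
  obtain ⟨b, hbs, hbt⟩ := h2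
  obtain ⟨z, -, hz1, hz2⟩ := hs (interior t) (closure t)ᶜ isOpen_interior
    isClosed_closure.isOpen_compl
    (fun z hz => (em (z ∈ closure t)).imp (hint z hz) id)
    ⟨a, has, hint a has (subset_closure hat)⟩
    ⟨b, hbs, fun hbc => hbt (interior_subset (hint b hbs hbc))⟩
  exact hz2 (subset_closure (interior_subset hz1))

/-- From any point `p` of a bounded set through another of its points `x` there is a ray, which
leaves the set beyond `x` at a boundary point. -/
theorem exists_mem_frontier_mem_segment {K : Set (EuclideanSpace ℝ (Fin n))}
    (hK : Bornology.IsBounded K) {p x : EuclideanSpace ℝ (Fin n)} (hx : x ∈ K) (hpx : p ≠ x) :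
    ∃ y ∈ frontier K, x ∈ segment ℝ p y := by
  have hpre : IsPreconnected ((fun t : ℝ => x + t • (x - p)) '' Set.Ici 0) :=
    isPreconnected_Ici.image _ (by fun_prop)
  obtain ⟨M, hM⟩ := hK.subset_closedBall x
  have hpos : 0 < ‖x - p‖ := norm_pos_iff.2 (sub_ne_zero.2 hpx.symm)
  obtain ⟨y, ⟨t, ht, rfl⟩, hy⟩ := inter_frontier_nonempty_of_isPreconnected hpre (t := K)
    ⟨x, ⟨0, Set.mem_Ici.2 le_rfl, by simp⟩, hx⟩
    ⟨_, ⟨(|M| + 1) / ‖x - p‖, Set.mem_Ici.2 (by positivity), rfl⟩, fun h => by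
      have := hM h
      rw [mem_closedBall_iff_norm, add_sub_cancel_left, norm_smul,
        Real.norm_of_nonneg (by positivity), div_mul_cancel₀ _ hpos.ne'] at this
      linarith [le_abs_self M]⟩
  have ht : 0 ≤ t := ht
  refine ⟨_, hy, t / (1 + t), 1 / (1 + t), by positivity, by positivity, ?_, ?_⟩
  · field_simp
    ring
  · have h : (1 + t) ≠ 0 := by positivity
    match_scalars
    · field_simp
      ring
    · field_simp

/-- Carathéodory's theorem for `c`-extremal points. -/
theorem exists_cExt_of_mem (hn : 0 < n) {K : Set (EuclideanSpace ℝ (Fin n))}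
    (hK : cHull K = K) (hR : outradius K < 1) {x : EuclideanSpace ℝ (Fin n)} (hx : x ∈ K) :
    ∃ m : ℕ, m ≤ n + 1 ∧ ∃ p : Fin m → EuclideanSpace ℝ (Fin n),
      (∀ i, p i ∈ cExt K) ∧ x ∈ cHull (Set.range p) := by
  obtain ⟨w, R, -, -, hw⟩ := exists_subset_closedBall_of_outradius_lt_one hR
  have hKb : Bornology.IsBounded K := Metric.isBounded_closedBall.subset fun a ha =>
    mem_closedBall_iff_norm.2 (hw a ha)
  have : Nonempty (Fin n) := ⟨⟨0, hn⟩⟩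
  obtain ⟨q, hq⟩ := exists_ne x
  obtain ⟨y₀, hy₀, -⟩ := exists_mem_frontier_mem_segment hKb hx hq
  obtain ⟨p, hp⟩ : (cExt K).Nonempty := by
    obtain ⟨m, -, p, hp, hmem⟩ := exists_cExt_of_mem_frontier hn hK hR hy₀
    rcases m with - | m
    -- The dual of `∅` is the whole space, so its `c`-hull is empty and `m = 0` cannot occur.
    · exfalso
      have hempty : Set.range p = ∅ := Set.range_eq_empty p
      rw [hempty] at hmem
      obtain ⟨v, hv⟩ := NormedSpace.exists_lt_norm ℝ (EuclideanSpace ℝ (Fin n)) 1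
      have := mem_cDual.1 hmem (y₀ - v) (mem_cDual.2 (by simp))
      rw [sub_sub_cancel] at this
      linarith
    · exact ⟨p 0, hp 0⟩
  rcases eq_or_ne p x with rfl | hpx
  · exact ⟨1, by omega, fun _ => p, fun _ => hp, subset_cHull _ ⟨0, rfl⟩⟩
  obtain ⟨y, hy, hxy⟩ := exists_mem_frontier_mem_segment hKb hx hpx
  obtain ⟨m, hm, r, hr, hmem⟩ := exists_cExt_of_mem_frontier hn hK hR hy
  refine ⟨m + 1, by omega, Fin.cons p r, Fin.cases hp hr, ?_⟩
  refine (convex_cDual _).segment_subset (subset_cHull _ (Set.mem_range_self 0))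
    (cHull_mono ?_ hmem) hxy
  rintro _ ⟨i, rfl⟩
  exact ⟨i.succ, rfl⟩

end Extremal

theorem mainTheorem4 (n : ℕ) (hn : 2 ≤ n) (K : Set (EuclideanSpace ℝ (Fin n)))
    (hK : IsBallBody K) (hR : outradius K < 1) :
    (∀ x ∈ frontier K, ∃ m : ℕ, m ≤ n ∧ ∃ p : Fin m → EuclideanSpace ℝ (Fin n),
      (∀ i, p i ∈ cExt K) ∧ x ∈ cHull (Set.range p)) ∧
    (∀ x ∈ K, ∃ m : ℕ, m ≤ n + 1 ∧ ∃ p : Fin m → EuclideanSpace ℝ (Fin n),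
      (∀ i, p i ∈ cExt K) ∧ x ∈ cHull (Set.range p)) ∧
    K = cHull (cExt K) := by

  have hn : 0 < n := by omega
  have hKK := hK.cHull_eq
  refine ⟨fun x hx => exists_cExt_of_mem_frontier hn hKK hR hx,
    fun x hx => exists_cExt_of_mem hn hKK hR hx, Set.Subset.antisymm (fun x hx => ?_) ?_⟩
  · obtain ⟨m, -, p, hp, hmem⟩ := exists_cExt_of_mem hn hKK hR hx
    exact cHull_mono (Set.range_subset_iff.2 hp) hmem
  · conv_rhs => rw [← hKK]
    exact cHull_mono fun x hx => hx.1
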